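/- Fix an integer $\sigma\ge 2$. A \emph{one-stream machine} over an alphabet $A$ of size $\sigma$ has a finite set of memory configurations, one read/write stream whose cells initially hold the characters of the input string and may also hold symbols of a finite auxiliary alphabet, and an append-only binary output. It works in passes: in each pass it goes over the whole stream once, in a direction chosen from its memory configuration before the pass, and at each cell it changes its memory configuration, overwrites the cell and appends some (possibly no) bits to the output, depending only on its memory configuration and on the contents of the cell. On reaching the far end of the stream it may do the same, writing beyond that end; before each pass it may decide to halt. It uses \emph{$m$ bits of memory} if it has at most $2^m$ memory configurations. Let $H_k(s)$ be the $k$th-order empirical entropy of a string $s$ of length $n$, \[ H_0(s)=\frac1n\sum_{a\in A}\mathrm{occ}(a,s)\log_2\frac{n}{\mathrm{occ}(a,s)},\qquad H_k(s)=\frac1n\sum_{|w|=k}|w_s|\,H_0(w_s)\quad(k\ge 1), \] where $\mathrm{occ}(a,s)$ is the number of occurrences of $a$ in $s$ (terms with $\mathrm{occ}(a,s)=0$ and empty $w_s$ count $0$) and $w_s$ is the concatenation of the characters immediately following the occurrences of the $k$-tuple $w$ in $s$. Let $m,p:\mathbb N\to\mathbb N$ and $r:\mathbb N\to[0,\infty)$.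 Suppose that for each $n$ there is a one-stream machine with $m(n)$ bits of memory that halts on every string of length $n$ after at most $p(n)$ passes, whose complete outputs on different strings of length $n$ are different (lossless compression), and that these machines achieve redundancy $O(\sigma^k r)$ for all $k$ simultaneously: there is a constant $C$ such that, for all sufficiently large $n$, every $k\ge 0$ and every string $s\in A^n$, the complete output on $s$ has at most $nH_k(s)+C\,\sigma^k\,r(n)$ bits. Then, for every function $f:\mathbb N\to\mathbb R$ with $f(n)\to\infty$, \[ m(n)\,p(n)\,r(n)=\Omega\bigl(n/f(n)\bigr). \] -/

import Mathlib

open Filter Asymptotics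

section Entropy

variable {A : Type} [Fintype A] [DecidableEq A]

/-- The 0th-order empirical entropy `(1 / n) ∑ₐ occ(a, s) log₂ (n / occ(a, s))` of a string `s` of
length `n` (characters that do not occur contribute `0`). -/
noncomputable def empEntropyZero (s : List A) : ℝ :=
  (1 / (s.length : ℝ)) *
    ∑ a : A, (s.count a : ℝ) * Real.logb 2 ((s.length : ℝ) / (s.count a : ℝ))

/-- The string `w_s`: the concatenation of the characters of `s` that immediately follow the
(possibly overlapping) occurrences of `w` in `s`. -/
def followers (w s : List A) : List A :=
  (List.range s.length).filterMap fun i =>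
    if (s.drop i).take w.length = w then s[i + w.length]? else none

/-- The `k`th-order empirical entropy `H_k(s)`: for `k ≥ 1` it is
`(1 / n) ∑_{|w| = k} |w_s| H_0(w_s)`. -/
noncomputable def empEntropy : ℕ → List A → ℝ
  | 0, s => empEntropyZero s
  | k + 1, s => (1 / (s.length : ℝ)) *
      ∑ w : Fin (k + 1) → A,
        ((followers (List.ofFn w) s).length : ℝ) * empEntropyZero (followers (List.ofFn w) s)

end Entropy

/-- What a machine does when it stands between two passes: it makes another pass, in one of the
two directions, or it stops. -/
inductive PassAction
  | forward
  | backward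
  | halt

/-- A deterministic machine with one read/write stream and an append-only output.

`Mem` is the set of all memory configurations of the machine, its control state included. The cells
of the stream hold characters of the input alphabet `A` or auxiliary symbols from `Work`.
While over a cell, the machine reads it and, depending on its memory configuration, changes that
configuration, overwrites the cell and outputs some bits. Cells may be overwritten by any number of
symbols, so the stream may grow or shrink; overwriting by a single symbol is the in-place case. -/
structure StreamMachine (A : Type) where
  Mem : Type
  mem_finite : Finite Mem
  Work : Type
  work_finite : Finite Work
  /-- The initial memory configuration. -/
  start : Mem
  /-- The decision taken before each pass. -/
  control : Mem → PassAction
  /-- Processing one cell: new memory configuration, new contents of the cell, output bits. -/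
  step : Mem → A ⊕ Work → Mem × List (A ⊕ Work) × List Bool
  /-- Reaching the far end of the stream: new memory configuration, symbols written beyond that
  end, output bits. -/
  finish : Mem → Mem × List (A ⊕ Work) × List Bool

namespace StreamMachine

variable {A : Type} (M : StreamMachine A)

/-- One pass over the cells, in the order in which they are listed. The result is the memory
configuration after the pass, the new cells in the order of writing, and the bits output. -/
def scan : M.Mem → List (A ⊕ M.Work) → M.Mem × List (A ⊕ M.Work) × List Bool
  | q, [] => M.finish q
  | q, x :: l =>
    let a := M.step q x
    let b := scan a.1 l
    (b.1, a.2.1 ++ b.2.1, a.2.2 ++ b.2.2)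

/-- The complete output of the machine when it is started between two passes with the given memory
configuration and the given stream, or `none` if it does not stop after at most `p` passes. -/
def run : ℕ → M.Mem → List (A ⊕ M.Work) → Option (List Bool)
  | 0, q, _ =>
    match M.control q with
    | .halt => some []
    | .forward => none
    | .backward => none
  | p + 1, q, l =>
    match M.control q with
    | .halt => some []
    | .forward =>
      let a := M.scan q l
      (run p a.1 a.2.1).map (a.2.2 ++ ·)
    | .backward =>
      let a := M.scan q l.reverse
      (run p a.1 a.2.1.reverse).map (a.2.2 ++ ·)

/-- The complete output on the input string `s`, or `none` if more than `p` passes are made. -/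
def output (p : ℕ) (s : List A) : Option (List Bool) :=
  M.run p M.start (s.map Sum.inl)

/-- On the strings of length `n`, the machine is a lossless compressor that uses at most `m` bits of
memory and at most `p` passes. -/
structure IsCompressor (n m p : ℕ) : Prop where
  memory : Nat.card M.Mem ≤ 2 ^ m
  passes : ∀ s : List A, s.length = n → ∃ o, M.output p s = some o
  lossless : ∀ s t : List A, s.length = n → t.length = n → M.output p s = M.output p t → s = t

end StreamMachine

/-- The machines `M n`, run on the strings of length `n` with at most `p n` passes, store every
string `s` in `n H_k(s) + O(σ^k r(n))` bits for all `k` simultaneously, where `σ` is the alphabet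
size; the hidden constant depends neither on `s` nor on `k`. -/
def HasRedundancy {σ : ℕ} (M : ℕ → StreamMachine (Fin σ)) (p : ℕ → ℕ) (r : ℕ → ℝ) : Prop :=
  ∃ C : ℝ, ∀ᶠ n in atTop, ∀ (k : ℕ) (s : List (Fin σ)), s.length = n →
    ∀ o, (M n).output (p n) s = some o →
      (o.length : ℝ) ≤ n * empEntropy k s + C * ((σ : ℝ) ^ k * r n)

/-!
The bound proved is `n ≤ K m p r` for large `n`, with `K` depending only on `σ` and on the constant
in the redundancy; the function `f` only weakens it.

Let `l = 24 m p` and feed the machine the words of length `n` that repeat a cyclic word of length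
`l`. Two estimates of the output length, averaged over all `σ ^ l` cyclic words, are compared.

*Lower bound.* All that the processing of the rest of the stream depends on in a block is its trace:
for each pass the direction, the memory configurations on entering and on leaving the block, and
the bits output in between. A block may be exchanged for any block that replays its trace
(`StreamMachine.run_eq_of_replays`), so losslessness makes a block a function of its trace
(`StreamMachine.IsCompressor.block_eq_of_trace_eq`). The memory configurations contribute `O(m p)`
bits to a trace. A Kraft inequality over traces, which also pays for the way in which the output is
divided among the passes, then shows that the `σ ^ l` possible contents of a block cost on average
at least `l / 2 - 3 m p = 9 m p` bits, in each of the `n / l` repetitions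
(`StreamMachine.IsCompressor.mul_card_le_sum_traceBits`). The bits output over disjoint blocks add
up, so the average output has `Ω(n)` bits.

*Upper bound.* Choose `k` with `64 σ l ≤ σ ^ k ≤ 64 σ ^ 2 l`. Contexts of length `k` that occur only
once in the cyclic word contribute nothing to the `k`th-order entropy of its repetition
(`mul_empEntropy_periodicWord_le`), and in a random cyclic word two given windows of length `k`
agree with probability at most `σ ^ -k` (`card_cyclicWindow_eq_le`). Hence `n H_k` is on average at
most `n / 32` (`sum_mul_empEntropy_periodicWord_le`).

Together these give `n = O(σ ^ k r) = O(m p r)`. If `l > n` this argument is empty, but then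
`m p > n / 24`, and `r` is bounded below because constant strings have entropy `0` and cannot all
have an empty output (`one_le_redundancy`).
-/

/-! ### Passes over parts of the stream -/

namespace StreamMachine

variable {A : Type} (M : StreamMachine A)

/-- The part of a pass that goes over the given cells, without what happens at the far end of the
stream: the memory configuration afterwards, the new cells in the order of writing, and the bits
output. -/
def scanPart : M.Mem → List (A ⊕ M.Work) → M.Mem × List (A ⊕ M.Work) × List Bool
  | q, [] => (q, [], [])
  | q, x :: l =>
    let a := M.step q x
    let b := scanPart a.1 l
    (b.1, a.2.1 ++ b.2.1, a.2.2 ++ b.2.2)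

theorem scanPart_append (q : M.Mem) (l l' : List (A ⊕ M.Work)) :
    M.scanPart q (l ++ l') =
      ((M.scanPart (M.scanPart q l).1 l').1,
        (M.scanPart q l).2.1 ++ (M.scanPart (M.scanPart q l).1 l').2.1,
        (M.scanPart q l).2.2 ++ (M.scanPart (M.scanPart q l).1 l').2.2) := by
  induction l generalizing q with
  | nil => simp [scanPart]
  | cons x l ih => simp [scanPart, ih]

theorem scan_eq (q : M.Mem) (l : List (A ⊕ M.Work)) :
    M.scan q l =
      ((M.finish (M.scanPart q l).1).1,
        (M.scanPart q l).2.1 ++ (M.finish (M.scanPart q l).1).2.1,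
        (M.scanPart q l).2.2 ++ (M.finish (M.scanPart q l).1).2.2) := by
  induction l generalizing q with
  | nil => simp [scan, scanPart]
  | cons x l ih => simp [scan, scanPart, ih]

/-! ### The trace of a block of the stream -/

/-- What can be observed of a block of the stream during one pass: whether the pass is a forward
one, the memory configurations in which the machine enters and leaves the block, and the bits that
it outputs in between. -/
abbrev Visit : Type := (Bool × M.Mem × M.Mem) × List Bool

/-- The visits, during at most `p` passes, to the middle block `X` of a stream `U ++ X ++ V`. What
is written beyond an end of the stream is counted to the outer block at that end. -/
def trace : ℕ → M.Mem → List (A ⊕ M.Work) → List (A ⊕ M.Work) → List (A ⊕ M.Work) → List M.Visit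
  | 0, _, _, _, _ => []
  | p + 1, q, U, X, V =>
    match M.control q with
    | .halt => []
    | .forward =>
      let a := M.scanPart q U
      let b := M.scanPart a.1 X
      let c := M.scanPart b.1 V
      let e := M.finish c.1
      ((true, a.1, b.1), b.2.2) :: trace p e.1 a.2.1 b.2.1 (c.2.1 ++ e.2.1)
    | .backward =>
      let a := M.scanPart q V.reverse
      let b := M.scanPart a.1 X.reverse
      let c := M.scanPart b.1 U.reverse
      let e := M.finish c.1
      ((false, a.1, b.1), b.2.2) ::
        trace p e.1 (c.2.1 ++ e.2.1).reverse b.2.1.reverse a.2.1.reverse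

/-- `M.Replays T X` says that a block with contents `X`, visited in the directions and entered in
the memory configurations listed in `T`, makes the machine leave it and output as listed in `T`. -/
def Replays : List M.Visit → List (A ⊕ M.Work) → Prop
  | [], _ => True
  | ((true, q, q'), o) :: T, X =>
    (M.scanPart q X).1 = q' ∧ (M.scanPart q X).2.2 = o ∧ Replays T (M.scanPart q X).2.1
  | ((false, q, q'), o) :: T, X =>
    (M.scanPart q X.reverse).1 = q' ∧ (M.scanPart q X.reverse).2.2 = o ∧
      Replays T (M.scanPart q X.reverse).2.1.reverse

/-- The number of bits output over a block with the given trace. -/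
def traceBits (T : List M.Visit) : ℕ := (T.map fun v => v.2.length).sum

theorem length_trace_le (p : ℕ) (q : M.Mem) (U X V : List (A ⊕ M.Work)) :
    (M.trace p q U X V).length ≤ p := by
  induction p generalizing q U X V with
  | zero => simp [trace]
  | succ p ih =>
    rw [trace]
    cases M.control q <;> simp [ih]

theorem replays_trace (p : ℕ) (q : M.Mem) (U X V : List (A ⊕ M.Work)) :
    M.Replays (M.trace p q U X V) X := by
  induction p generalizing q U X V with
  | zero => simp [trace, Replays]
  | succ p ih =>
    rw [trace]
    cases M.control q <;> simp [Replays, ih]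

/-- A block may be exchanged for any block that replays its trace: the rest of the stream and the
output do not notice. -/
theorem run_eq_of_replays (p : ℕ) (q : M.Mem) (U X Y V : List (A ⊕ M.Work))
    (h : M.Replays (M.trace p q U X V) Y) : M.run p q (U ++ Y ++ V) = M.run p q (U ++ X ++ V) := by
  induction p generalizing q U X Y V with
  | zero => simp [run]
  | succ p ih =>
    rw [trace] at h
    rw [run, run]
    cases hc : M.control q <;> simp only [hc, Replays] at h ⊢
    · obtain ⟨h1, h2, h3⟩ := h
      have := ih _ _ _ _ _ h3
      simp only [scan_eq, scanPart_append, h1, h2, ← List.append_assoc] at this ⊢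
      rw [this]
    · obtain ⟨h1, h2, h3⟩ := h
      have := ih _ _ _ _ _ h3
      simp only [scan_eq, scanPart_append, h1, h2, List.reverse_append, ← List.append_assoc]
        at this ⊢
      rw [this]

theorem traceBits_le_length (p : ℕ) (q : M.Mem) (U X V : List (A ⊕ M.Work)) (o : List Bool)
    (h : M.run p q (U ++ X ++ V) = some o) : M.traceBits (M.trace p q U X V) ≤ o.length := by
  induction p generalizing q U X V o with
  | zero => simp [trace, traceBits]
  | succ p ih =>
    rw [trace]
    rw [run] at h
    cases hc : M.control q <;> simp only [hc] at h ⊢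
    · obtain ⟨o', h1, rfl⟩ := Option.map_eq_some_iff.1 h
      have := ih (U := (M.scanPart q U).2.1) (X := (M.scanPart (M.scanPart q U).1 X).2.1)
        (V := (M.scanPart (M.scanPart (M.scanPart q U).1 X).1 V).2.1 ++
          (M.finish (M.scanPart (M.scanPart (M.scanPart q U).1 X).1 V).1).2.1) (o := o')
        (q := (M.finish (M.scanPart (M.scanPart (M.scanPart q U).1 X).1 V).1).1)
        (by simpa [scan_eq, scanPart_append] using h1)
      simp only [traceBits, List.map_cons, List.sum_cons, scan_eq, scanPart_append,
        List.length_append] at this ⊢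
      omega
    · obtain ⟨o', h1, rfl⟩ := Option.map_eq_some_iff.1 h
      simp only [List.reverse_append, scan_eq, scanPart_append] at h1
      have := ih (o := o')
        (U := ((M.scanPart (M.scanPart (M.scanPart q V.reverse).1 X.reverse).1 U.reverse).2.1 ++
          (M.finish (M.scanPart (M.scanPart (M.scanPart q V.reverse).1 X.reverse).1
            U.reverse).1).2.1).reverse)
        (X := (M.scanPart (M.scanPart q V.reverse).1 X.reverse).2.1.reverse)
        (V := (M.scanPart q V.reverse).2.1.reverse)
        (q := (M.finish (M.scanPart (M.scanPart (M.scanPart q V.reverse).1 X.reverse).1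
            U.reverse).1).1)
        (by simpa using h1)
      simp only [traceBits, List.map_cons, List.sum_cons, scan_eq, scanPart_append,
        List.length_append, List.reverse_append] at this ⊢
      omega
    · simp [traceBits]

theorem traceBits_trace_append (p : ℕ) (q : M.Mem) (U X Y V : List (A ⊕ M.Work)) :
    M.traceBits (M.trace p q U (X ++ Y) V) =
      M.traceBits (M.trace p q U X (Y ++ V)) + M.traceBits (M.trace p q (U ++ X) Y V) := by
  induction p generalizing q U X Y V with
  | zero => simp [trace, traceBits]
  | succ p ih =>
    rw [trace, trace, trace]
    cases hc : M.control q <;> simp only [traceBits]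
    · simp only [traceBits] at ih
      simp only [List.map_cons, List.sum_cons, scanPart_append, List.length_append, ih,
        List.append_assoc]
      omega
    · simp only [traceBits] at ih
      simp only [List.map_cons, List.sum_cons, scanPart_append, List.length_append, ih,
        List.append_assoc, List.reverse_append]
      omega
    · simp

theorem traceBits_trace_nil (p : ℕ) (q : M.Mem) (U V : List (A ⊕ M.Work)) :
    M.traceBits (M.trace p q U [] V) = 0 := by
  have := M.traceBits_trace_append p q U [] [] V
  simp only [List.append_nil, List.nil_append] at this
  omega

/-- Blocks in the same place of two inputs are equal as soon as they have the same trace. -/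
theorem IsCompressor.block_eq_of_trace_eq {M : StreamMachine A} {n m p : ℕ}
    (hM : M.IsCompressor n m p) {u x v u' x' v' : List A}
    (hn : (u ++ x ++ v).length = n) (hx : x.length = x'.length)
    (h : M.trace p M.start (u.map Sum.inl) (x.map Sum.inl) (v.map Sum.inl) =
      M.trace p M.start (u'.map Sum.inl) (x'.map Sum.inl) (v'.map Sum.inl)) : x = x' := by
  have hrep := M.replays_trace p M.start (u'.map Sum.inl) (x'.map Sum.inl) (v'.map Sum.inl)
  rw [← h] at hrep
  have hrun := M.run_eq_of_replays _ _ _ _ _ _ hrep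
  have := hM.lossless (u ++ x' ++ v) (u ++ x ++ v) (by simp at hn ⊢; omega) hn
    (by simpa [output] using hrun)
  simpa using this.symm

/-! ### Degenerate machines -/

/-- A machine with a single memory configuration halts at once or never, and a machine that makes no
pass has no output, so a compressor needs both memory and passes. -/
theorem IsCompressor.one_le_memory_and_passes {M : StreamMachine A} {n m p : ℕ} [Nontrivial A]
    (hM : M.IsCompressor n m p) (hn : 1 ≤ n) : 1 ≤ m ∧ 1 ≤ p := by
  obtain ⟨a, b, hab⟩ := exists_pair_ne A
  have hne : M.control M.start ≠ .halt := by
    intro hc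
    refine hab (List.replicate_right_injective (n := n) (by omega)
      (hM.lossless (List.replicate n a) (List.replicate n b) (by simp) (by simp) ?_))
    cases p <;> simp [output, run, hc]
  obtain ⟨o, ho⟩ := hM.passes (List.replicate n a) (by simp)
  constructor
  · by_contra hm
    have hcard := hM.memory
    obtain rfl : m = 0 := by omega
    have := M.mem_finite
    have hsub : Subsingleton M.Mem := Finite.card_le_one_iff_subsingleton.1 (by simpa using hcard)
    have hnone : ∀ (p : ℕ) (q : M.Mem) (l : List (A ⊕ M.Work)), M.run p q l = none := by
      intro p
      induction p with
      | zero =>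
        intro q l
        rw [run]
        cases hc : M.control q <;> simp_all [Subsingleton.elim q M.start]
      | succ p ih =>
        intro q l
        rw [run]
        cases hc : M.control q <;> simp_all [Subsingleton.elim q M.start]
    simp [output, hnone] at ho
  · by_contra hp
    obtain rfl : p = 0 := by omega
    rw [output, run] at ho
    cases hc : M.control M.start <;> simp_all

end StreamMachine

/-! ### Kraft sums -/

/-- A Kraft inequality for lists: each letter has a weight, the weight of a list is the product of
the weights of its letters, and all letters together weigh at most `c`. Then the lists of length at
most `p` together weigh at most `B p`, for any `B` that grows at least like the partial sums of the
geometric series in `c`. -/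
theorem sum_list_prod_le {α : Type*} [DecidableEq α] (w : α → ℝ) (hw : ∀ a, 0 ≤ w a) (c : ℝ)
    (hc : ∀ S : Finset α, ∑ a ∈ S, w a ≤ c) (B : ℕ → ℝ) (hB0 : 1 ≤ B 0)
    (hB : ∀ p, 1 + c * B p ≤ B (p + 1)) (p : ℕ) (S : Finset (List α))
    (hS : ∀ l ∈ S, l.length ≤ p) : ∑ l ∈ S, (l.map w).prod ≤ B p := by
  have hw' : ∀ l : List α, 0 ≤ (l.map w).prod := fun l =>
    List.prod_nonneg fun x hx => by
      obtain ⟨a, -, rfl⟩ := List.mem_map.1 hx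
      exact hw a
  induction p generalizing S with
  | zero =>
    have hsub : S ⊆ {[]} := fun l hl => by
      simpa using hS l hl
    exact (Finset.sum_le_sum_of_subset_of_nonneg hsub fun l _ _ => hw' l).trans (by simpa using hB0)
  | succ p ih =>
    have hc0 : 0 ≤ c := by simpa using hc ∅
    let H : Finset α := S.biUnion fun l => l.toFinset
    let S' : Finset (List α) := S.image List.tail
    have hsub : S ⊆ insert [] ((H ×ˢ S').image fun z => z.1 :: z.2) := by
      intro l hl
      cases l with
      | nil => simp
      | cons a l =>
        refine Finset.mem_insert_of_mem (Finset.mem_image.2 ⟨(a, l), ?_, rfl⟩)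
        refine Finset.mem_product.2 ⟨Finset.mem_biUnion.2 ⟨_, hl, by simp⟩,
          Finset.mem_image.2 ⟨_, hl, rfl⟩⟩
    have hS' : ∑ l ∈ S', (l.map w).prod ≤ B p := ih S' fun l hl => by
      obtain ⟨l', hl', rfl⟩ := Finset.mem_image.1 hl
      have := hS l' hl'
      rw [List.length_tail]
      omega
    calc ∑ l ∈ S, (l.map w).prod
        ≤ ∑ l ∈ insert [] ((H ×ˢ S').image fun z => z.1 :: z.2), (l.map w).prod :=
          Finset.sum_le_sum_of_subset_of_nonneg hsub fun l _ _ => hw' l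
      _ = 1 + ∑ z ∈ H ×ˢ S', w z.1 * (z.2.map w).prod := by
          rw [Finset.sum_insert (by simp), Finset.sum_image]
          · simp
          · rintro ⟨a, l⟩ _ ⟨b, l'⟩ _ h
            simpa using h
      _ = 1 + (∑ a ∈ H, w a) * ∑ l ∈ S', (l.map w).prod := by
          rw [Finset.sum_mul_sum, Finset.sum_product]
      _ ≤ 1 + c * B p := by
          have h1 := mul_le_mul (hc H) hS' (Finset.sum_nonneg fun l _ => hw' l) hc0
          linarith
      _ ≤ B (p + 1) := hB p

theorem sum_quarter_pow_length_le (S : Finset (List Bool)) :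
    ∑ o ∈ S, (1 / 4 : ℝ) ^ o.length ≤ 2 := by
  have h := sum_list_prod_le (α := Bool) (fun _ => 1 / 4) (fun _ => by norm_num) (1 / 2)
    (fun S => by
      have h : (S.card : ℝ) ≤ 2 := by exact_mod_cast S.card_le_univ
      simp only [Finset.sum_const, nsmul_eq_mul]
      linarith)
    (fun _ => 2) (by norm_num) (fun _ => by norm_num) (S.sup List.length) S
    (fun l hl => Finset.le_sup (f := List.length) hl)
  simpa using h

theorem sum_quarter_pow_visits_le {β : Type*} [Fintype β] [DecidableEq β] (p : ℕ)
    (S : Finset (List (β × List Bool))) (hS : ∀ T ∈ S, T.length ≤ p) :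
    ∑ T ∈ S, (1 / 4 : ℝ) ^ (T.map fun v => v.2.length).sum ≤ (1 + 2 * Fintype.card β) ^ p := by
  have h := sum_list_prod_le (α := β × List Bool) (fun v => (1 / 4) ^ v.2.length)
    (fun _ => by positivity) (2 * Fintype.card β)
    (fun S => by
      calc ∑ v ∈ S, (1 / 4 : ℝ) ^ v.2.length
          ≤ ∑ v ∈ Finset.univ ×ˢ S.image Prod.snd, (1 / 4 : ℝ) ^ v.2.length :=
            Finset.sum_le_sum_of_subset_of_nonneg
              (fun v hv => Finset.mem_product.2 ⟨Finset.mem_univ _, Finset.mem_image_of_mem _ hv⟩)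
              fun _ _ _ => by positivity
        _ = Fintype.card β * ∑ o ∈ S.image Prod.snd, (1 / 4 : ℝ) ^ o.length := by
            rw [Finset.sum_product]
            simp
        _ ≤ Fintype.card β * 2 := by
            gcongr
            exact sum_quarter_pow_length_le _
        _ = 2 * Fintype.card β := mul_comm _ _)
    (fun p => (1 + 2 * Fintype.card β) ^ p) (by simp)
    (fun p => by
      have : (1 : ℝ) ≤ (1 + 2 * Fintype.card β) ^ p := one_le_pow₀ (by
        have : (0 : ℝ) ≤ Fintype.card β := by positivity
        linarith)
      rw [pow_succ]
      linarith) p S hS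
  refine le_of_eq_of_le (Finset.sum_congr rfl fun T _ => ?_) h
  have hT : ∀ T : List (β × List Bool), (1 / 4 : ℝ) ^ (T.map fun v => v.2.length).sum =
      (T.map fun v => (1 / 4 : ℝ) ^ v.2.length).prod := by
    intro T
    induction T with
    | nil => rfl
    | cons v T ih => rw [List.map_cons, List.sum_cons, pow_add, ih, List.map_cons, List.prod_cons]
  exact hT T

/-- If the Kraft sum of natural numbers `b i` is small, then their average is large: the sum of the
`b i` is at least `a` times their number. -/
theorem mul_card_le_sum_of_kraft {ι : Type*} [Fintype ι] (b : ι → ℕ) (a : ℕ)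
    (h : ∑ i, (1 / 4 : ℝ) ^ b i * 4 ^ a ≤ Fintype.card ι) :
    (a : ℝ) * Fintype.card ι ≤ ∑ i, (b i : ℝ) := by
  -- the tangent inequality `4 ^ t ≥ 1 + t` at `t = a - b i`
  have key : ∀ i, (a : ℝ) + 1 - (1 / 4 : ℝ) ^ b i * 4 ^ a ≤ b i := by
    intro i
    rcases le_total a (b i) with hab | hab
    · rcases hab.eq_or_lt with hab | hab
      · rw [← hab, ← mul_pow]
        norm_num
      · have h1 : (a : ℝ) + 1 ≤ b i := by exact_mod_cast hab
        have h2 : (0 : ℝ) ≤ (1 / 4 : ℝ) ^ b i * 4 ^ a := by positivity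
        linarith
    · obtain ⟨d, rfl⟩ := Nat.exists_eq_add_of_le hab
      have h1 : (1 / 4 : ℝ) ^ b i * 4 ^ (b i + d) = 4 ^ d := by
        rw [pow_add, ← mul_assoc, ← mul_pow]
        norm_num
      have h2 : ((d : ℝ) + 1) ≤ 4 ^ d := by
        exact_mod_cast Nat.lt_pow_self (n := d) (by norm_num : 1 < 4)
      rw [h1]
      push_cast
      linarith
  have h1 := Finset.sum_le_sum fun i (_ : i ∈ Finset.univ) => key i
  rw [Finset.sum_sub_distrib, Finset.sum_const, Finset.card_univ, nsmul_eq_mul] at h1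
  linarith

/-- Over the blocks `x i`, placed into possibly different inputs, a compressor outputs on average
at least `a` bits, provided that there are at least `4 ^ (a + 3 m p)` of them. -/
theorem StreamMachine.IsCompressor.mul_card_le_sum_traceBits {A : Type} {M : StreamMachine A}
    {n m p : ℕ} (hM : M.IsCompressor n m p) (hm : 1 ≤ m) {ι : Type*} [Fintype ι]
    (u x v : ι → List A) (hx : Function.Injective x) (l : ℕ) (hl : ∀ i, (x i).length = l)
    (hn : ∀ i, (u i ++ x i ++ v i).length = n) (a : ℕ)
    (ha : 4 ^ (a + 3 * m * p) ≤ Fintype.card ι) :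
    (a : ℝ) * Fintype.card ι ≤ ∑ i, (M.traceBits (M.trace p M.start ((u i).map Sum.inl)
      ((x i).map Sum.inl) ((v i).map Sum.inl)) : ℝ) := by
  classical
  have := M.mem_finite
  have := Fintype.ofFinite M.Mem
  refine mul_card_le_sum_of_kraft _ _ ?_
  let T : ι → List M.Visit := fun i =>
    M.trace p M.start ((u i).map Sum.inl) ((x i).map Sum.inl) ((v i).map Sum.inl)
  have hT : Function.Injective T := fun i j hij =>
    hx (hM.block_eq_of_trace_eq (hn i) ((hl i).trans (hl j).symm) hij)
  have hk := sum_quarter_pow_visits_le p (Finset.univ.image T) fun t ht => by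
    obtain ⟨i, -, rfl⟩ := Finset.mem_image.1 ht
    exact M.length_trace_le _ _ _ _ _
  rw [Finset.sum_image hT.injOn] at hk
  have hcard : (1 + 2 * (Fintype.card (Bool × M.Mem × M.Mem) : ℝ)) ≤ 4 ^ (3 * m) := by
    have h1 := hM.memory
    rw [Nat.card_eq_fintype_card] at h1
    have h2 : 1 + 2 * Fintype.card (Bool × M.Mem × M.Mem) ≤ 4 ^ (3 * m) := by
      calc 1 + 2 * Fintype.card (Bool × M.Mem × M.Mem)
          = 1 + 4 * (Fintype.card M.Mem * Fintype.card M.Mem) := by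
            simp only [Fintype.card_prod, Fintype.card_bool]
            ring
        _ ≤ 1 + 4 * (2 ^ m * 2 ^ m) := by gcongr
        _ = 1 + 4 * 4 ^ m := by
            rw [← mul_pow]
            norm_num
        _ ≤ 4 ^ (m + 2) := by
            have := Nat.one_le_pow m 4 (by norm_num)
            rw [pow_add]
            omega
        _ ≤ 4 ^ (3 * m) := Nat.pow_le_pow_right (by norm_num) (by omega)
    exact_mod_cast h2
  rw [← Finset.sum_mul]
  calc (∑ i, (1 / 4 : ℝ) ^ M.traceBits (T i)) * 4 ^ a
      ≤ (4 ^ (3 * m)) ^ p * 4 ^ a := by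
        gcongr
        exact hk.trans (by gcongr)
    _ = ((4 ^ (a + 3 * m * p) : ℕ) : ℝ) := by
        push_cast
        rw [← pow_mul, ← pow_add, add_comm]
    _ ≤ Fintype.card ι := by exact_mod_cast ha

/-! ### Bounds for the empirical entropies -/

section Entropy

variable {A : Type} [Fintype A] [DecidableEq A]

theorem length_mul_empEntropyZero_eq_zero {s : List A} (h : ∀ a ∈ s, ∀ b ∈ s, a = b) :
    (s.length : ℝ) * empEntropyZero s = 0 := by
  have : ∀ a : A, (s.count a : ℝ) * Real.logb 2 ((s.length : ℝ) / (s.count a : ℝ)) = 0 := by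
    intro a
    by_cases ha : a ∈ s
    · have hc : s.count a = s.length := List.count_eq_length.2 fun b hb => h a ha b hb
      have hne : (s.length : ℝ) ≠ 0 := by
        have := List.length_pos_of_mem ha
        positivity
      rw [hc, div_self hne, Real.logb_one, mul_zero]
    · simp [List.count_eq_zero_of_not_mem ha]
  simp [empEntropyZero, this]

/-- A crude bound, which suffices because the alphabet is fixed: `c log₂ (n / c) ≤ 2 n` for each
character. -/
theorem length_mul_empEntropyZero_le (s : List A) :
    (s.length : ℝ) * empEntropyZero s ≤ 2 * Fintype.card A * s.length := by
  rcases s.eq_nil_or_concat' with rfl | ⟨l, b, hs⟩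
  · simp
  have hn : (0 : ℝ) < s.length := by
    rw [hs]
    simp
    positivity
  have key : ∀ a : A, (s.count a : ℝ) * Real.logb 2 ((s.length : ℝ) / (s.count a : ℝ)) ≤
      2 * s.length := by
    intro a
    rcases (s.count a).eq_zero_or_pos with h0 | h0
    · rw [h0]
      simp
    · have hc : (0 : ℝ) < s.count a := by exact_mod_cast h0
      have h1 := Real.log_le_sub_one_of_pos (div_pos hn hc)
      have h2 : (s.count a : ℝ) * Real.log ((s.length : ℝ) / (s.count a : ℝ)) ≤ s.length := by
        calc (s.count a : ℝ) * Real.log ((s.length : ℝ) / (s.count a : ℝ))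
            ≤ s.count a * ((s.length : ℝ) / (s.count a : ℝ)) := by
              gcongr
              linarith
          _ = s.length := by field_simp
      have h3 := Real.log_two_gt_d9
      rw [← Real.log_div_log, ← mul_div_assoc, div_le_iff₀ (by linarith)]
      nlinarith
  have h := Finset.sum_le_sum fun a (_ : a ∈ Finset.univ) => key a
  rw [Finset.sum_const, Finset.card_univ, nsmul_eq_mul] at h
  rw [empEntropyZero, ← mul_assoc, mul_one_div_cancel hn.ne', one_mul]
  linarith

end Entropy

/-! ### Periodic words -/

/-- The prefix of length `n` of the infinite repetition of the cyclic word `x`. -/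
def periodicWord {A : Type} {l : ℕ} (x : ZMod l → A) (n : ℕ) : List A :=
  (List.range n).map fun i : ℕ => x (i : ZMod l)

/-- The `k` consecutive characters of the cyclic word `x` that start at `i`. -/
def cyclicWindow {A : Type} {l : ℕ} (x : ZMod l → A) (k : ℕ) (i : ZMod l) : Fin k → A :=
  fun t => x (i + (t : ℕ))

@[simp]
theorem length_periodicWord {A : Type} {l : ℕ} (x : ZMod l → A) (n : ℕ) :
    (periodicWord x n).length = n := by
  simp [periodicWord]

theorem periodicWord_zero {A : Type} {l : ℕ} (x : ZMod l → A) : periodicWord x 0 = [] := rfl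

theorem periodicWord_mul_add {A : Type} {l : ℕ} (x : ZMod l → A) (j n : ℕ) :
    periodicWord x (j * l + n) = periodicWord x (j * l) ++ periodicWord x n := by
  simp [periodicWord, List.range_add]

theorem periodicWord_injective {A : Type} {l : ℕ} [NeZero l] :
    Function.Injective fun x : ZMod l → A => periodicWord x l := by
  intro x y h
  funext i
  have h1 := List.map_inj_left.1 h i.val (List.mem_range.2 i.val_lt)
  simpa using h1

/-- The hypothesis is that the position `i` contributes `c` to `followers (List.ofFn w)`. -/
theorem eq_of_mem_followers_periodicWord {A : Type} [DecidableEq A] {l : ℕ} {x : ZMod l → A}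
    {n k i : ℕ} {w : Fin k → A} {c : A}
    (h : (if ((periodicWord x n).drop i).take (List.ofFn w).length = List.ofFn w then
      (periodicWord x n)[i + (List.ofFn w).length]? else none) = some c) :
    w = cyclicWindow x k i ∧ c = x (i + k) := by
  split_ifs at h with hw
  rw [List.length_ofFn] at h hw
  have hlt : i + k < n := by
    have := (List.getElem?_eq_some_iff.1 h).1
    simpa using this
  refine ⟨?_, ?_⟩
  · funext t
    have h1 : (List.ofFn w)[(t : ℕ)]? = some (w t) := by simp
    rw [← hw, List.getElem?_take_of_lt t.2, List.getElem?_drop] at h1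
    have h2 : i + t < n := by omega
    simp only [periodicWord, List.getElem?_map, List.getElem?_range h2] at h1
    simpa [cyclicWindow] using h1.symm
  · simp only [periodicWord, List.getElem?_map, List.getElem?_range hlt] at h
    simpa using h.symm

/-- A context that occurs only once in the cyclic word `x` is always followed by the same character,
so the entropy is bounded by the number of repetitions of contexts. -/
theorem mul_empEntropy_periodicWord_le {A : Type} [Fintype A] [DecidableEq A] {l : ℕ} [NeZero l]
    (x : ZMod l → A) (n k : ℕ) (hn : 0 < n) (hk : 0 < k) :
    n * empEntropy k (periodicWord x n) ≤ 2 * Fintype.card A * ∑ i ∈ Finset.range n,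
      ((Finset.univ.filter fun b : ZMod l =>
        b ≠ (i : ℕ) ∧ cyclicWindow x k b = cyclicWindow x k (i : ℕ)).card : ℝ) := by
  classical
  obtain ⟨k, rfl⟩ : ∃ j, k = j + 1 := ⟨k - 1, by omega⟩
  have hn' : (n : ℝ) ≠ 0 := by positivity
  rw [empEntropy, length_periodicWord, ← mul_assoc, mul_one_div_cancel hn', one_mul]
  let R : ℕ → Prop := fun i =>
    ∃ b : ZMod l, b ≠ i ∧ cyclicWindow x (k + 1) b = cyclicWindow x (k + 1) i
  have hword : ∀ w : Fin (k + 1) → A,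
      ((followers (List.ofFn w) (periodicWord x n)).length : ℝ) *
        empEntropyZero (followers (List.ofFn w) (periodicWord x n)) ≤
      2 * Fintype.card A * ∑ i ∈ Finset.range n,
        if w = cyclicWindow x (k + 1) (i : ℕ) ∧ R i then (1 : ℝ) else 0 := by
    intro w
    by_cases hconst : ∀ a ∈ followers (List.ofFn w) (periodicWord x n),
        ∀ b ∈ followers (List.ofFn w) (periodicWord x n), a = b
    · rw [length_mul_empEntropyZero_eq_zero hconst]
      have : ∀ i, (0 : ℝ) ≤ if w = cyclicWindow x (k + 1) (i : ℕ) ∧ R i then (1 : ℝ) else 0 := by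
        intro i
        split_ifs <;> norm_num
      have := Finset.sum_nonneg fun i (_ : i ∈ Finset.range n) => this i
      positivity
    · refine (length_mul_empEntropyZero_le _).trans ?_
      gcongr
      push Not at hconst
      obtain ⟨a, ha, b, hb, hab⟩ := hconst
      obtain ⟨i, -, hi⟩ := List.mem_filterMap.1 ha
      obtain ⟨j, -, hj⟩ := List.mem_filterMap.1 hb
      obtain ⟨hwi, hai⟩ := eq_of_mem_followers_periodicWord hi
      obtain ⟨hwj, hbj⟩ := eq_of_mem_followers_periodicWord hj
      have hij : (i : ZMod l) ≠ j := by
        rintro h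
        exact hab (by rw [hai, hbj, h])
      -- `w` occurs at two different places, hence every occurrence of `w` is a repetition
      have hR : ∀ t : ℕ, w = cyclicWindow x (k + 1) t → R t := by
        intro t ht
        by_cases hit : (i : ZMod l) = t
        · exact ⟨j, fun h => hij (hit.trans h.symm), by rw [← hwj, ht]⟩
        · exact ⟨i, hit, by rw [← hwi, ht]⟩
      rw [Finset.sum_boole, followers, length_periodicWord, List.length_filterMap_eq_countP,
        ← Nat.count_eq_card_filter_range, Nat.count_eq_card_filter_range,
        ← Nat.count_eq_card_filter_range, Nat.count]
      norm_cast
      refine List.countP_mono_left fun t _ ht => ?_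
      obtain ⟨c, hc⟩ := Option.isSome_iff_exists.1 ht
      have := (eq_of_mem_followers_periodicWord hc).1
      simpa using ⟨this, hR t this⟩
  refine (Finset.sum_le_sum fun w _ => hword w).trans ?_
  rw [← Finset.mul_sum, Finset.sum_comm]
  gcongr with i
  by_cases hRi : R i
  · have hRi' := hRi
    obtain ⟨b, hb⟩ := hRi'
    simp only [hRi, and_true, Finset.sum_ite_eq', Finset.mem_univ, if_true]
    exact_mod_cast Finset.card_pos.2 ⟨b, by simpa using hb⟩
  · simp [hRi]

/-! ### Repetitions in random cyclic words -/

/-- Two given windows of length `k` agree in a fraction of at most `|A| ^ -k` of all cyclic words,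
even if they overlap. If the window at `b` starts after the window at `a` and does not reach around
to `a`, it is determined, from left to right, by the rest of the word. -/
theorem card_cyclicWindow_eq_le_of_val {A : Type} [Fintype A] [DecidableEq A] {l : ℕ} [NeZero l]
    (k : ℕ) (a b : ZMod l) (hab : (b - a).val + k ≤ l) (hne : a ≠ b) :
    (Finset.univ.filter fun x : ZMod l → A =>
      cyclicWindow x k a = cyclicWindow x k b).card ≤ Fintype.card A ^ (l - k) := by
  classical
  let S : Finset (ZMod l) := (Finset.range k).image fun t : ℕ => b + t
  have hpos : 0 < (b - a).val := by
    rw [Nat.pos_iff_ne_zero, Ne, ZMod.val_eq_zero, sub_eq_zero]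
    exact hne.symm
  have hS : S.card = k := by
    rw [Finset.card_image_of_injOn, Finset.card_range]
    intro s hs t ht hst
    have hs' : s < k := by simpa using hs
    have ht' : t < k := by simpa using ht
    have h1 : (s : ZMod l) = t := by simpa using hst
    have h2 := congrArg ZMod.val h1
    rwa [ZMod.val_natCast_of_lt (by omega), ZMod.val_natCast_of_lt (by omega)] at h2
  have hcard : Fintype.card ({z // z ∉ S} → A) = Fintype.card A ^ (l - k) := by
    rw [Fintype.card_fun, Fintype.card_subtype_compl, ZMod.card, Fintype.card_coe, hS]
  rw [← hcard, ← Finset.card_univ]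
  refine Finset.card_le_card_of_injOn (fun x z => x z) (fun _ _ => Finset.mem_univ _) ?_
  intro x hx y hy hxy
  have hx' : cyclicWindow x k a = cyclicWindow x k b := by simpa using hx
  have hy' : cyclicWindow y k a = cyclicWindow y k b := by simpa using hy
  have hout : ∀ z, z ∉ S → x z = y z := fun z hz => congrFun hxy ⟨z, hz⟩
  have hin : ∀ t : ℕ, t < k → x (b + t) = y (b + t) := by
    intro t
    induction t using Nat.strong_induction_on with
    | _ t ih =>
      intro ht
      have h1 : x (a + t) = x (b + t) := congrFun hx' ⟨t, ht⟩
      have h2 : y (a + t) = y (b + t) := congrFun hy' ⟨t, ht⟩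
      rw [← h1, ← h2]
      by_cases hz : a + (t : ZMod l) ∈ S
      · obtain ⟨s, hs, hst⟩ := Finset.mem_image.1 hz
        have hs' : s < k := by simpa using hs
        have hts : ((s + (b - a).val : ℕ) : ZMod l) = (t : ℕ) := by
          rw [Nat.cast_add, ZMod.natCast_zmod_val]
          linear_combination hst
        have h3 := congrArg ZMod.val hts
        rw [ZMod.val_natCast_of_lt (by omega), ZMod.val_natCast_of_lt (by omega)] at h3
        rw [← hst]
        exact ih s (by omega) hs'
      · exact hout _ hz
  funext z
  by_cases hz : z ∈ S
  · obtain ⟨t, ht, rfl⟩ := Finset.mem_image.1 hz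
    exact hin t (by simpa using ht)
  · exact hout z hz

/-- If `2 * k ≤ l`, one of the two windows does not reach around to the start of the other. -/
theorem card_cyclicWindow_eq_le {A : Type} [Fintype A] [DecidableEq A] {l : ℕ} [NeZero l]
    (k : ℕ) (hk : 2 * k ≤ l) (a b : ZMod l) (hne : a ≠ b) :
    (Finset.univ.filter fun x : ZMod l → A =>
      cyclicWindow x k a = cyclicWindow x k b).card ≤ Fintype.card A ^ (l - k) := by
  have hneg : (a - b).val + (b - a).val = l := by
    have : NeZero (b - a) := ⟨sub_ne_zero.2 hne.symm⟩
    rw [← neg_sub b a, ZMod.val_neg_of_ne_zero]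
    have := (b - a).val_lt
    omega
  rcases le_total (b - a).val (a - b).val with h | h
  · exact card_cyclicWindow_eq_le_of_val k a b (by omega) hne
  · simp_rw [eq_comm (a := cyclicWindow _ k a)]
    exact card_cyclicWindow_eq_le_of_val k b a (by omega) hne.symm

/-- The entropies of the periodic words of period `l`, summed over all of these words. -/
theorem sum_mul_empEntropy_periodicWord_le {A : Type} [Fintype A] [DecidableEq A] {l : ℕ} [NeZero l]
    (n k : ℕ) (hn : 0 < n) (hk : 0 < k) (hkl : 2 * k ≤ l) :
    ∑ x : ZMod l → A, n * empEntropy k (periodicWord x n) ≤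
      2 * Fintype.card A * (n * (l * (Fintype.card A : ℝ) ^ (l - k))) := by
  refine (Finset.sum_le_sum fun x _ => mul_empEntropy_periodicWord_le x n k hn hk).trans ?_
  rw [← Finset.mul_sum, Finset.sum_comm]
  gcongr
  have h : ∀ i ∈ Finset.range n, ∑ x : ZMod l → A, ((Finset.univ.filter fun b : ZMod l =>
      b ≠ (i : ℕ) ∧ cyclicWindow x k b = cyclicWindow x k (i : ℕ)).card : ℝ) ≤
      l * (Fintype.card A : ℝ) ^ (l - k) := by
    intro i _
    have h1 : ∑ x : ZMod l → A, (Finset.univ.filter fun b : ZMod l =>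
        b ≠ (i : ℕ) ∧ cyclicWindow x k b = cyclicWindow x k (i : ℕ)).card ≤
        l * Fintype.card A ^ (l - k) := by
      simp_rw [Finset.card_filter]
      rw [Finset.sum_comm]
      calc ∑ b : ZMod l, ∑ x : ZMod l → A,
            (if b ≠ i ∧ cyclicWindow x k b = cyclicWindow x k i then 1 else 0)
          ≤ ∑ _b : ZMod l, Fintype.card A ^ (l - k) := by
            refine Finset.sum_le_sum fun b _ => ?_
            by_cases hb : b = i
            · simp [hb]
            · simpa [hb] using card_cyclicWindow_eq_le (A := A) k hkl b i hb
        _ = l * Fintype.card A ^ (l - k) := by simp [ZMod.card]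
    exact_mod_cast h1
  refine (Finset.sum_le_sum h).trans ?_
  simp

/-! ### The trade-off -/

namespace StreamMachine

/-- The bits output over the successive periods of a periodic word are part of the output. -/
theorem sum_traceBits_periods_le {A : Type} (M : StreamMachine A) (p n l : ℕ) (x : ZMod l → A)
    (o : List Bool) (ho : M.output p (periodicWord x n) = some o) (N : ℕ) (hN : N * l ≤ n) :
    ∑ j ∈ Finset.range N, M.traceBits (M.trace p M.start ((periodicWord x (j * l)).map Sum.inl)
      ((periodicWord x l).map Sum.inl) ((periodicWord x (n - (j + 1) * l)).map Sum.inl)) ≤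
      o.length := by
  have key : ∀ N, N * l ≤ n → ∑ j ∈ Finset.range N, M.traceBits (M.trace p M.start
      ((periodicWord x (j * l)).map Sum.inl) ((periodicWord x l).map Sum.inl)
      ((periodicWord x (n - (j + 1) * l)).map Sum.inl)) =
      M.traceBits (M.trace p M.start [] ((periodicWord x (N * l)).map Sum.inl)
        ((periodicWord x (n - N * l)).map Sum.inl)) := by
    intro N
    induction N with
    | zero => simp [periodicWord_zero, traceBits_trace_nil]
    | succ N ih =>
      intro h
      have h1 : (N + 1) * l = N * l + l := by ring
      have h2 : n - N * l = 1 * l + (n - (N + 1) * l) := by omega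
      rw [Finset.sum_range_succ, ih (by omega), h2, periodicWord_mul_add, h1, periodicWord_mul_add,
        List.map_append, List.map_append, traceBits_trace_append, List.nil_append, one_mul]
  rw [key N hN]
  refine M.traceBits_le_length p M.start _ _ _ o ?_
  have h : N * l + (n - N * l) = n := by omega
  rw [List.nil_append, ← List.map_append, ← periodicWord_mul_add, h]
  exact ho

end StreamMachine

/-- Constant strings have entropy `0`, and at most one of them has an empty output. -/
theorem one_le_redundancy {σ : ℕ} (hσ : 2 ≤ σ) {M : StreamMachine (Fin σ)} {n m p : ℕ}
    (hM : M.IsCompressor n m p) (hn : 1 ≤ n) {R : ℝ}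
    (hR : ∀ (s : List (Fin σ)), s.length = n → ∀ o, M.output p s = some o →
      (o.length : ℝ) ≤ n * empEntropy 0 s + R) : 1 ≤ R := by
  by_contra hlt
  have hnil : ∀ a : Fin σ, M.output p (List.replicate n a) = some [] := by
    intro a
    obtain ⟨o, ho⟩ := hM.passes (List.replicate n a) (by simp)
    have h1 := hR _ (by simp) o ho
    have h2 := length_mul_empEntropyZero_eq_zero (s := List.replicate n a) (by
      intro b hb c hc
      rw [List.eq_of_mem_replicate hb, List.eq_of_mem_replicate hc])
    rw [List.length_replicate] at h2
    rw [empEntropy, h2] at h1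
    have h3 : (o.length : ℝ) < 1 := by linarith
    have h4 : o.length = 0 := by
      have : o.length < 1 := by exact_mod_cast h3
      omega
    rw [ho, List.length_eq_zero_iff.1 h4]
  have h := hM.lossless (List.replicate n ⟨0, by omega⟩) (List.replicate n ⟨1, by omega⟩)
    (by simp) (by simp) (by rw [hnil, hnil])
  have h1 := List.replicate_right_injective (n := n) (by omega) h
  simp at h1

theorem mul_le_two_pow (h : ℕ) (hh : 12 ≤ h) : 128 * h ≤ 2 ^ (h - 1) := by
  induction h, hh using Nat.le_induction with
  | base => norm_num
  | succ h hh ih =>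
    obtain ⟨j, rfl⟩ : ∃ j, h = j + 1 := ⟨h - 1, by omega⟩
    simp only [Nat.add_sub_cancel] at ih ⊢
    rw [pow_succ]
    omega

/-- A context length `k` such that windows of length `k` rarely repeat in words of length `l`, with
`σ ^ k` still linear in `l`. -/
theorem exists_context_length {σ l : ℕ} (hσ : 2 ≤ σ) (hl : 24 ≤ l) (heven : 2 ∣ l) :
    ∃ k, 0 < k ∧ 2 * k ≤ l ∧ 64 * σ * l ≤ σ ^ k ∧ σ ^ k ≤ 64 * σ ^ 2 * l := by
  obtain ⟨h, rfl⟩ := heven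
  have hbig : 64 * σ * (2 * h) ≤ σ ^ h := by
    calc 64 * σ * (2 * h) = σ * (128 * h) := by ring
      _ ≤ σ * 2 ^ (h - 1) := by
        gcongr
        exact mul_le_two_pow h (by omega)
      _ ≤ σ * σ ^ (h - 1) := by gcongr
      _ = σ ^ h := by
        rw [← pow_succ']
        congr 1
        omega
  have hone : 1 < 64 * σ * (2 * h) := by
    have : 1 ≤ σ * h := Nat.mul_pos (by omega) (by omega)
    nlinarith
  have hpos : 0 < Nat.clog σ (64 * σ * (2 * h)) := Nat.clog_pos (by omega) hone
  refine ⟨Nat.clog σ (64 * σ * (2 * h)), hpos, ?_, Nat.le_pow_clog (by omega) _, ?_⟩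
  · have := (Nat.clog_le_iff_le_pow (b := σ) (by omega)).2 hbig
    omega
  · have h1 := Nat.pow_pred_clog_lt_self (b := σ) (by omega) hone
    calc σ ^ Nat.clog σ (64 * σ * (2 * h))
        = σ * σ ^ (Nat.clog σ (64 * σ * (2 * h)) - 1) := by
          rw [← pow_succ']
          congr 1
          omega
      _ ≤ σ * (64 * σ * (2 * h)) := by
          gcongr
          exact h1.le
      _ = 64 * σ ^ 2 * (2 * h) := by ring

/-- If a compressor achieves redundancy `R`, at a suitable context length `k`, then `R ≥ n / 16`:
compare the lower and the upper bound for its average output on the words of period `24 m p`. -/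
theorem le_redundancy_of_period_le {σ : ℕ} (hσ : 2 ≤ σ) {M : StreamMachine (Fin σ)} {n m p k : ℕ}
    (hM : M.IsCompressor n m p) (hm : 1 ≤ m) (hp : 1 ≤ p) (hln : 24 * m * p ≤ n) (hk : 0 < k)
    (hkl : 2 * k ≤ 24 * m * p) (hσk : 64 * σ * (24 * m * p) ≤ σ ^ k) {R : ℝ}
    (hR : ∀ (s : List (Fin σ)), s.length = n → ∀ o, M.output p s = some o →
      (o.length : ℝ) ≤ n * empEntropy k s + R) : (n : ℝ) ≤ 16 * R := by
  have hmp : 1 ≤ m * p := Nat.mul_pos hm hp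
  obtain ⟨l, hl⟩ : ∃ l, l = 24 * m * p := ⟨_, rfl⟩
  rw [← hl] at hln hkl hσk
  have hl24 : l = 24 * (m * p) := by rw [hl, mul_assoc]
  have : NeZero l := ⟨by omega⟩
  have hcard : Fintype.card (ZMod l → Fin σ) = σ ^ l := by simp [ZMod.card]
  choose o ho using fun x : ZMod l → Fin σ =>
    hM.passes (periodicWord x n) (length_periodicWord x n)
  let N := n / l
  have hNl : N * l ≤ n := Nat.div_mul_le_self n l
  have hperiod : ∀ j ∈ Finset.range N, ((9 * (m * p) : ℕ) : ℝ) * σ ^ l ≤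
      ∑ x : ZMod l → Fin σ, (M.traceBits (M.trace p M.start
        ((periodicWord x (j * l)).map Sum.inl) ((periodicWord x l).map Sum.inl)
        ((periodicWord x (n - (j + 1) * l)).map Sum.inl)) : ℝ) := by
    intro j hj
    have h1 : (j + 1) * l ≤ n :=
      (Nat.mul_le_mul_right l (Nat.succ_le_of_lt (Finset.mem_range.1 hj))).trans hNl
    have h2 := hM.mul_card_le_sum_traceBits hm (fun x : ZMod l → Fin σ => periodicWord x (j * l))
      (fun x => periodicWord x l) (fun x => periodicWord x (n - (j + 1) * l))
      periodicWord_injective l (fun x => length_periodicWord x l)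
      (fun x => by
        have : (j + 1) * l = j * l + l := by ring
        simp only [List.length_append, length_periodicWord]
        omega)
      (9 * (m * p)) (by
        rw [hcard]
        calc 4 ^ (9 * (m * p) + 3 * m * p) = 2 ^ l := by
              rw [hl24, show 9 * (m * p) + 3 * m * p = 12 * (m * p) by ring,
                show (4 : ℕ) = 2 ^ 2 by norm_num, ← pow_mul]
              congr 1
              ring
          _ ≤ σ ^ l := Nat.pow_le_pow_left hσ l)
    rw [hcard] at h2
    exact_mod_cast h2
  have hlower : (N : ℝ) * (((9 * (m * p) : ℕ) : ℝ) * σ ^ l) ≤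
      ∑ x : ZMod l → Fin σ, ((o x).length : ℝ) := by
    have h1 := Finset.sum_le_sum hperiod
    rw [Finset.sum_const, Finset.card_range, nsmul_eq_mul, Finset.sum_comm] at h1
    refine h1.trans (Finset.sum_le_sum fun x _ => ?_)
    exact_mod_cast M.sum_traceBits_periods_le p n l x (o x) (ho x) N hNl
  have hupper : ∑ x : ZMod l → Fin σ, ((o x).length : ℝ) ≤
      2 * σ * (n * (l * (σ : ℝ) ^ (l - k))) + σ ^ l * R := by
    have h1 := Finset.sum_le_sum fun (x : ZMod l → Fin σ) (_ : x ∈ Finset.univ) =>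
      hR _ (length_periodicWord x n) (o x) (ho x)
    rw [Finset.sum_add_distrib, Finset.sum_const, Finset.card_univ, hcard, nsmul_eq_mul] at h1
    have h2 := sum_mul_empEntropy_periodicWord_le (A := Fin σ) (l := l) n k (by omega) hk hkl
    rw [Fintype.card_fin] at h2
    push_cast at h1
    linarith
  -- the number of periods is at least `n / (2 l)`
  have hN : (n : ℝ) ≤ 2 * (N * l) := by
    have h1 : n < N * l + l := Nat.lt_div_mul_add (by omega)
    have h2 : 1 * l ≤ N * l := Nat.mul_le_mul_right l (Nat.div_pos hln (by omega))
    have h3 : n ≤ 2 * (N * l) := by omega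
    exact_mod_cast h3
  have hpos : (0 : ℝ) < (σ : ℝ) ^ l := by positivity
  have hsmall : 64 * (σ * (n * (l * (σ : ℝ) ^ (l - k)))) ≤ n * σ ^ l := by
    have h1 : (64 * σ * l : ℝ) ≤ σ ^ k := by exact_mod_cast hσk
    have h2 : (σ : ℝ) ^ l = σ ^ k * σ ^ (l - k) := by
      rw [← pow_add]
      congr 1
      omega
    calc 64 * (σ * (n * (l * (σ : ℝ) ^ (l - k)))) = n * ((64 * σ * l) * σ ^ (l - k)) := by ring
      _ ≤ n * (σ ^ k * σ ^ (l - k)) := by gcongr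
      _ = n * σ ^ l := by rw [h2]
  have hmain : (n : ℝ) * σ ^ l ≤ 16 * R * σ ^ l := by
    have h1 : (l : ℝ) = 24 * (m * p) := by exact_mod_cast hl24
    have h2 : 3 * n * (σ : ℝ) ^ l ≤ 16 * ((N : ℝ) * (((9 * (m * p) : ℕ) : ℝ) * σ ^ l)) := by
      calc 3 * n * (σ : ℝ) ^ l ≤ 3 * (2 * (N * l)) * (σ : ℝ) ^ l := by gcongr
        _ = 16 * ((N : ℝ) * (((9 * (m * p) : ℕ) : ℝ) * σ ^ l)) := by
          rw [h1]
          push_cast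
          ring
    nlinarith
  exact le_of_mul_le_mul_right hmain hpos

theorem mainTheorem6 (σ : ℕ) (hσ : 2 ≤ σ) (M : ℕ → StreamMachine (Fin σ))
    (m p : ℕ → ℕ) (r : ℕ → ℝ) (hr : ∀ n, 0 ≤ r n)
    (hM : ∀ n, (M n).IsCompressor n (m n) (p n)) (hred : HasRedundancy M p r) :
    ∀ f : ℕ → ℝ, Tendsto f atTop atTop →
      (fun n : ℕ => (n : ℝ) / f n) =O[atTop] (fun n : ℕ => (m n : ℝ) * (p n : ℝ) * r n) := by
  intro f hf
  obtain ⟨C, hC⟩ := hred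
  have : Nontrivial (Fin σ) := Fin.nontrivial_iff_two_le.2 hσ
  -- `16 * 64 * σ ^ 2 * 24` comes from `n ≤ 16 C σ ^ k r` and `σ ^ k ≤ 64 σ ^ 2 (24 m p)`
  refine IsBigO.of_bound (24576 * σ ^ 2 * C) ?_
  filter_upwards [hC, eventually_ge_atTop 1, hf.eventually_ge_atTop 1] with n hCn hn hfn
  obtain ⟨hm, hp⟩ := (hM n).one_le_memory_and_passes hn
  have hmp : (1 : ℝ) ≤ m n * p n := by exact_mod_cast Nat.mul_pos hm hp
  have hone : 1 ≤ C * r n := one_le_redundancy hσ (hM n) hn fun s hs o ho => by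
    simpa using hCn 0 s hs o ho
  have hσ' : (1 : ℝ) ≤ (σ : ℝ) ^ 2 := one_le_pow₀ (by exact_mod_cast (by omega : 1 ≤ σ))
  have hbound : (n : ℝ) ≤ 24576 * σ ^ 2 * C * (m n * p n * r n) := by
    rcases le_or_gt (24 * m n * p n) n with hln | hln
    · have h24 : 24 ≤ 24 * m n * p n := by
        rw [mul_assoc]
        exact Nat.le_mul_of_pos_right _ (Nat.mul_pos hm hp)
      obtain ⟨k, hk, hkl, hk1, hk2⟩ := exists_context_length hσ h24
        (by rw [mul_assoc]; exact (by norm_num : 2 ∣ 24).mul_right _)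
      have h1 := le_redundancy_of_period_le hσ (hM n) hm hp hln hk hkl hk1 (hCn k)
      have h2 : (σ : ℝ) ^ k ≤ 64 * σ ^ 2 * (24 * m n * p n) := by exact_mod_cast hk2
      calc (n : ℝ) ≤ 16 * (σ ^ k * (C * r n)) := by linarith
        _ ≤ 16 * (64 * σ ^ 2 * (24 * m n * p n) * (C * r n)) := by gcongr
        _ = 24576 * σ ^ 2 * C * (m n * p n * r n) := by ring
    · have h1 : (n : ℝ) ≤ 24 * m n * p n := by exact_mod_cast hln.le
      calc (n : ℝ) ≤ 24 * m n * p n := h1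
        _ = 24 * (m n * p n) * (1 * 1) := by ring
        _ ≤ 24576 * (m n * p n) * (σ ^ 2 * (C * r n)) := by gcongr; norm_num
        _ = 24576 * σ ^ 2 * C * (m n * p n * r n) := by ring
  have hnn : (0 : ℝ) ≤ m n * p n * r n := mul_nonneg (by linarith) (hr n)
  rw [Real.norm_of_nonneg (by positivity), Real.norm_of_nonneg hnn]
  exact (div_le_self (by positivity) hfn).trans hbound
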